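/- Let $p$ be a strictly positive probability density on $\mathbb{R}^d$ such that $\log p$ is $C^2$ and $\nabla\log p$ is $L$-Lipschitz. Let $\kappa:\mathbb{R}^d\times\mathbb{R}^d\to\mathbb{R}$ be a positive (semi)definite kernel of class $C^2$, let $\mathcal H_0$ be its reproducing kernel Hilbert space and $\mathcal H=\mathcal H_0^d$ with $\|\phi\|_{\mathcal H}^2=\sum_{i}\|\phi_i\|_{\mathcal H_0}^2$. For a vector field $\phi$ let $\mathcal A_p\phi(\lambda)=\phi(\lambda)\nabla\log p(\lambda)^{\top}+\nabla\phi(\lambda)\in\mathbb{R}^{d\times d}$ be the Stein operator, and for a probability measure $q$ let $$\mathbb D(q,p)=\sup_{\phi\in\mathcal H,\ \|\phi\|_{\mathcal H}\le 1}\mathbb E_{\lambda\sim q}\big[\operatorname{trace}\mathcal A_p\phi(\lambda)\big]$$ be the kernel Stein discrepancy. Write $\nabla_{\lambda,\lambda'}\kappa(\lambda,\lambda)=\sum_{j=1}^d\frac{\partial^2\kappa(\lambda,\lambda')}{\partial\lambda_j\,\partial\lambda'_j}\Big|_{\lambda'=\lambda}$. Fix $\varepsilon>0$ and a probability measure $q_0$,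 and let $q_0,q_1,q_2,\dots$ be the laws produced by Stein variational gradient descent with step size $\varepsilon$: $q_{t+1}$ is the law of $\lambda+\varepsilon\hat\phi_t(\lambda)$ for $\lambda\sim q_t$, where $$\hat\phi_t(\lambda)=\mathbb E_{\lambda'\sim q_t}\big[\kappa(\lambda,\lambda')\nabla\log p(\lambda')+\nabla_{\lambda'}\kappa(\lambda,\lambda')\big].$$ For each $t$ consider the following conditions: (a) $L\kappa(\lambda,\lambda)/2+\nabla_{\lambda,\lambda'}\kappa(\lambda,\lambda)$ is $q_t$-integrable, and $\operatorname{trace}\mathcal A_p\phi$ is $q_t$-integrable for every $\phi\in\mathcal H$; (b) $\varepsilon\,\|\nabla\hat\phi_t(\lambda)\|\le\tfrac12$ for all $\lambda\in\mathbb{R}^d$, in the spectral norm. 1. If (a) and (b) hold for some $t$ and $\mathrm{KL}(q_t\|p)<\infty$, then $\mathrm{KL}(q_{t+1}\|p)<\infty$ and $$\mathrm{KL}(q_{t+1}\|p)-\mathrm{KL}(q_t\|p)\le-\varepsilon\,\mathbb D(q_t,p)^2\Big(1-\varepsilon\,\mathbb E_{\lambda\sim q_t}\big[L\kappa(\lambda,\lambda)/2+\nabla_{\lambda,\lambda'}\kappa(\lambda,\lambda)\big]\Big).$$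 In particular $\mathrm{KL}(q_{t+1}\|p)\le\mathrm{KL}(q_t\|p)$ if $\varepsilon\,\mathbb E_{q_t}[L\kappa(\lambda,\lambda)/2+\nabla_{\lambda,\lambda'}\kappa(\lambda,\lambda)]\le1$, and the inequality is strict if moreover this product is $<1$ and $\mathbb D(q_t,p)\ne0$. 2. If for every $t$ conditions (a) and (b) hold and $\varepsilon\,\mathbb E_{q_t}[L\kappa(\lambda,\lambda)/2+\nabla_{\lambda,\lambda'}\kappa(\lambda,\lambda)]\le1$, then $t\mapsto\mathrm{KL}(q_t\|p)$ is non-increasing. -/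

import Mathlib

open MeasureTheory InformationTheory
open scoped NNReal ENNReal

noncomputable section

/-- The probability measure on `ℝ^d` with Lebesgue density `p`. -/
def targetMeasure {d : ℕ} (p : EuclideanSpace ℝ (Fin d) → ℝ) :
    Measure (EuclideanSpace ℝ (Fin d)) :=
  volume.withDensity (fun x => ENNReal.ofReal (p x))

/-- The score `∇ log p`. -/
def score {d : ℕ} (p : EuclideanSpace ℝ (Fin d) → ℝ) (x : EuclideanSpace ℝ (Fin d)) :
    EuclideanSpace ℝ (Fin d) :=
  gradient (fun y => Real.log (p y)) x

/-- The matrix-valued Stein operator `A_p φ (x) = φ(x) (∇ log p (x))ᵀ + ∇φ(x)` on vector fields;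
the `(i, j)` entry of `∇φ(x)` is `∂φ_i/∂x_j`. -/
def steinOperator {d : ℕ} (p : EuclideanSpace ℝ (Fin d) → ℝ)
    (φ : EuclideanSpace ℝ (Fin d) → EuclideanSpace ℝ (Fin d)) (x : EuclideanSpace ℝ (Fin d)) :
    Matrix (Fin d) (Fin d) ℝ :=
  Matrix.of fun i j => φ x i * score p x j + fderiv ℝ φ x (EuclideanSpace.single j 1) i

/-- The vector field `x ↦ (f_1(x), …, f_d(x))` given by an element `f` of `H^d`, where `H` is a
reproducing kernel Hilbert space of real functions on `ℝ^d`. The space `H^d` carries the Hilbert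
norm `‖f‖² = ∑ i, ‖f_i‖²`. -/
def rkhsField {d : ℕ} (H : Type*) [NormedAddCommGroup H] [InnerProductSpace ℝ H]
    [RKHS ℝ H (EuclideanSpace ℝ (Fin d)) ℝ] (f : PiLp 2 (fun _ : Fin d => H))
    (x : EuclideanSpace ℝ (Fin d)) : EuclideanSpace ℝ (Fin d) :=
  WithLp.toLp 2 (fun i => f i x)

/-- The expectations `E_q[trace (A_p φ)]`, `φ ∈ H^d`, exist. -/
def SteinIntegrable {d : ℕ} (H : Type*) [NormedAddCommGroup H] [InnerProductSpace ℝ H]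
    [RKHS ℝ H (EuclideanSpace ℝ (Fin d)) ℝ] (p : EuclideanSpace ℝ (Fin d) → ℝ)
    (q : Measure (EuclideanSpace ℝ (Fin d))) : Prop :=
  ∀ f : PiLp 2 (fun _ : Fin d => H),
    Integrable (fun x => (steinOperator p (rkhsField H f) x).trace) q

/-- The kernel Stein discrepancy `sup {E_q[trace (A_p φ)] : φ ∈ H^d, ‖φ‖ ≤ 1}`. -/
def steinDiscrepancy {d : ℕ} (H : Type*) [NormedAddCommGroup H] [InnerProductSpace ℝ H]
    [RKHS ℝ H (EuclideanSpace ℝ (Fin d)) ℝ] (q : Measure (EuclideanSpace ℝ (Fin d)))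
    (p : EuclideanSpace ℝ (Fin d) → ℝ) : ℝ :=
  sSup {r : ℝ | ∃ f : PiLp 2 (fun _ : Fin d => H), ‖f‖ ≤ 1 ∧
    r = ∫ x, (steinOperator p (rkhsField H f) x).trace ∂q}

/-- The SVGD direction
`φ̂_q(x) = E_{y ∼ q}[κ(x, y) ∇ log p (y) + ∇_y κ(x, y)]`. -/
def svgdDirection {d : ℕ} (p : EuclideanSpace ℝ (Fin d) → ℝ)
    (κ : EuclideanSpace ℝ (Fin d) → EuclideanSpace ℝ (Fin d) → ℝ)
    (q : Measure (EuclideanSpace ℝ (Fin d))) (x : EuclideanSpace ℝ (Fin d)) :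
    EuclideanSpace ℝ (Fin d) :=
  ∫ y, (κ x y • score p y + gradient (fun z => κ x z) y) ∂q

/-- One SVGD step: the law of `x + ε φ̂_q(x)` for `x ∼ q`. -/
def svgdStep {d : ℕ} (p : EuclideanSpace ℝ (Fin d) → ℝ)
    (κ : EuclideanSpace ℝ (Fin d) → EuclideanSpace ℝ (Fin d) → ℝ) (ε : ℝ)
    (q : Measure (EuclideanSpace ℝ (Fin d))) : Measure (EuclideanSpace ℝ (Fin d)) :=
  q.map (fun x => x + ε • svgdDirection p κ q x)

/-- The SVGD laws `q_0, q_1, q_2, …`. -/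
def svgdLaw {d : ℕ} (p : EuclideanSpace ℝ (Fin d) → ℝ)
    (κ : EuclideanSpace ℝ (Fin d) → EuclideanSpace ℝ (Fin d) → ℝ) (ε : ℝ)
    (q₀ : Measure (EuclideanSpace ℝ (Fin d))) : ℕ → Measure (EuclideanSpace ℝ (Fin d))
  | 0 => q₀
  | t + 1 => svgdStep p κ ε (svgdLaw p κ ε q₀ t)

/-- The step size is small for the direction `φ̂_q`: `ε ‖∇φ̂_q(x)‖ ≤ 1/2` at every point, in the
spectral norm. -/
def SmallStep {d : ℕ} (p : EuclideanSpace ℝ (Fin d) → ℝ)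
    (κ : EuclideanSpace ℝ (Fin d) → EuclideanSpace ℝ (Fin d) → ℝ) (ε : ℝ)
    (q : Measure (EuclideanSpace ℝ (Fin d))) : Prop :=
  ∀ x, ε * ‖fderiv ℝ (svgdDirection p κ q) x‖ ≤ 1 / 2

/-- The mixed derivative of the kernel on the diagonal,
`∇_{x,x'} κ(x, x) = ∑ j, ∂²κ(x, x')/∂x_j ∂x'_j` at `x' = x`. -/
def mixedDerivative {d : ℕ}
    (κ : EuclideanSpace ℝ (Fin d) → EuclideanSpace ℝ (Fin d) → ℝ)
    (x : EuclideanSpace ℝ (Fin d)) : ℝ :=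
  ∑ j : Fin d, fderiv ℝ (fun y => fderiv ℝ (fun z => κ y z) x (EuclideanSpace.single j 1)) x
    (EuclideanSpace.single j 1)

/-- The function `L κ(x, x) / 2 + ∇_{x,x'} κ(x, x)`. -/
def stepCost {d : ℕ} (L : ℝ≥0)
    (κ : EuclideanSpace ℝ (Fin d) → EuclideanSpace ℝ (Fin d) → ℝ)
    (x : EuclideanSpace ℝ (Fin d)) : ℝ :=
  (L : ℝ) * κ x x / 2 + mixedDerivative κ x

end

/-!
# Descent of the Kullback–Leibler divergence along Stein variational gradient descent

Write `k x = κ(x, ·)` for the feature map of the kernel. Since `κ` is `C²`, its mixed second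
differences converge, which makes the difference quotients of `k` Cauchy in the Hilbert space;
hence `k` is Fréchet differentiable (`differentiableAt_of_contDiff_inner`), and all derivatives of
elements of the space, as well as the mixed derivative of `κ` on the diagonal, are inner products
with `k` and its derivative. In particular `trace (A_p φ) (x)` is the inner product of `φ` with a
vector `ξ_x` of `H^d`. If these functions are `q`-integrable for all `φ`, the closed graph theorem
gives a vector `g` of `H^d` representing `φ ↦ E_q[trace (A_p φ)]`
(`exists_forall_integral_inner_eq_inner`). By the reproducing property `g` is the SVGD direction,
and `‖g‖` is the kernel Stein discrepancy (`exists_svgdDirection_eq_rkhsField`).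

Let `T x = x + ε φ x` with `φ` the field of `g`. The step size condition makes `T` a bijection
with invertible derivative, so the divergence of `T_* q` from `p` is that of `q` from
the pullback of `p`, whose density relative to `p` is
`e ^ r`, `r = log p(T x) - log p(x) + log |det DT(x)|`. The quadratic lower bound for functions with
`L`-Lipschitz gradient (`add_inner_gradient_sub_le`) and the bound
`log |det (1 + B)| ≥ trace B - ‖B‖²` in Frobenius norm for `B` of spectral norm at most `1/2`
(`log_abs_det_one_add_ge`) give
`r ≥ ε trace (A_p φ) - ε² (L/2 ‖φ‖² + ‖∇φ‖²)` pointwise. By Cauchy–Schwarz in the Hilbert space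
(`quadratic_error_le`) the quadratic error is at most `ε² ‖g‖²` times the step cost. This lower
bound is integrable with integral `ε ‖g‖² - ε² ‖g‖² E_q[step cost]`, and a lower bound on `r` is
enough for finiteness of the new divergence and for the descent inequality
(`klDiv_map_ne_top_and_sub_le`).
-/

/-! ### The determinant of a perturbation of the identity -/

open Module in
/-- The singular values of `C` are the lengths `‖C v i‖` for an orthonormal basis `v` of
eigenvectors of `Cᵀ C`, so their product is `|det C|`. -/
lemma exists_orthonormalBasis_abs_det_eq_prod {E : Type*} [NormedAddCommGroup E]
    [InnerProductSpace ℝ E] [FiniteDimensional ℝ E] (C : E →ₗ[ℝ] E) :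
    ∃ v : OrthonormalBasis (Fin (finrank ℝ E)) ℝ E, |LinearMap.det C| = ∏ i, ‖C (v i)‖ := by
  have hS : (LinearMap.adjoint C ∘ₗ C).IsSymmetric := C.isSymmetric_adjoint_comp_self
  refine ⟨hS.eigenvectorBasis rfl, ?_⟩
  have hev : ∀ i, hS.eigenvalues rfl i = ‖C (hS.eigenvectorBasis rfl i)‖ ^ 2 := by
    intro i
    have h := hS.apply_eigenvectorBasis rfl i
    have h2 : inner ℝ (hS.eigenvectorBasis rfl i)
        ((LinearMap.adjoint C ∘ₗ C) (hS.eigenvectorBasis rfl i)) =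
        ‖C (hS.eigenvectorBasis rfl i)‖ ^ 2 := by
      rw [LinearMap.comp_apply, LinearMap.adjoint_inner_right, real_inner_self_eq_norm_sq]
    rw [← h2, h, inner_smul_right, real_inner_self_eq_norm_sq,
      (hS.eigenvectorBasis rfl).orthonormal.1]
    simp
  rw [← sq_eq_sq₀ (abs_nonneg _) (Finset.prod_nonneg fun i _ => norm_nonneg _), ← Finset.prod_pow,
    sq_abs]
  simp_rw [← hev]
  have h := hS.det_eq_prod_eigenvalues rfl
  rw [← LinearMap.normDet_sq, LinearMap.normDet_eq_abs_det] at h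
  simpa using h

/-- The tangent-parabola bound behind `log_abs_det_one_add_ge`: the right-hand side is
`(s - 1) - (s - 1) ^ 2`. -/
lemma three_mul_sub_two_sub_sq_le_log {s : ℝ} (hs : 1 / 2 ≤ s) :
    3 * s - 2 - s ^ 2 ≤ Real.log s := by
  rcases le_total 1 s with h1 | h1
  · have h := Real.one_sub_inv_le_log_of_pos (show 0 < s by linarith)
    refine le_trans ?_ h
    have : s * s⁻¹ = 1 := mul_inv_cancel₀ (by linarith)
    have hi : 0 ≤ s⁻¹ := by positivity
    nlinarith [mul_nonneg hi (pow_nonneg (sub_nonneg.2 h1) 3)]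
  · -- `log x - (3 x - 2 - x ^ 2)` has derivative `(2 x - 1) (x - 1) / x ≤ 0` on `[1/2, 1]`.
    have hanti : AntitoneOn (fun x : ℝ => Real.log x - (3 * x - 2 - x ^ 2)) (Set.Icc (1 / 2) 1) := by
      have hd : ∀ x : ℝ, 1 / 2 ≤ x → HasDerivAt (fun x : ℝ => Real.log x - (3 * x - 2 - x ^ 2))
          (x⁻¹ - (3 - 2 * x)) x := by
        intro x hx
        have h1 := Real.hasDerivAt_log (show x ≠ 0 by linarith)
        have h2 := (((hasDerivAt_id x).const_mul 3).sub_const 2).sub ((hasDerivAt_id x).pow 2)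
        refine (h1.sub h2).congr_deriv ?_
        simp
      apply antitoneOn_of_deriv_nonpos (convex_Icc _ _)
      · exact fun x hx => (hd x hx.1).continuousAt.continuousWithinAt
      · intro x hx
        rw [interior_Icc] at hx
        exact (hd x hx.1.le).differentiableAt.differentiableWithinAt
      · intro x hx
        rw [interior_Icc] at hx
        rw [(hd x hx.1.le).deriv]
        have hx0 : 0 < x := by linarith [hx.1]
        have : x⁻¹ - (3 - 2 * x) = (2 * x - 1) * (x - 1) * x⁻¹ := by field_simp; ring
        rw [this]
        exact mul_nonpos_of_nonpos_of_nonneg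
          (mul_nonpos_of_nonneg_of_nonpos (by linarith [hx.1]) (by linarith [hx.2]))
          (inv_nonneg.2 hx0.le)
    have h := hanti ⟨hs, h1⟩ ⟨by norm_num, le_rfl⟩ h1
    norm_num at h
    linarith

/-- The squared Hilbert–Schmidt norm as a trace; in particular it does not depend on the
orthonormal basis. -/
lemma trace_adjoint_comp_self_eq_sum {E ι : Type*} [NormedAddCommGroup E]
    [InnerProductSpace ℝ E] [FiniteDimensional ℝ E] [Fintype ι] (B : E →ₗ[ℝ] E)
    (b : OrthonormalBasis ι ℝ E) :
    LinearMap.trace ℝ E (LinearMap.adjoint B ∘ₗ B) = ∑ i, ‖B (b i)‖ ^ 2 := by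
  rw [LinearMap.trace_eq_sum_inner _ b]
  refine Finset.sum_congr rfl fun i _ => ?_
  rw [LinearMap.comp_apply, LinearMap.adjoint_inner_right, real_inner_self_eq_norm_sq]

/-- A second-order lower bound for `log |det (1 + B)|`. With singular vectors `v i` and singular
values `σ i = ‖v i + B v i‖` of `1 + B`, it is the sum of the bounds
`log (σ i) ≥ 3 σ i - 2 - (σ i)²`, combined with `σ i ≥ ⟪v i, v i + B v i⟫`. -/
lemma log_abs_det_one_add_ge {E ι : Type*} [NormedAddCommGroup E]
    [InnerProductSpace ℝ E] [FiniteDimensional ℝ E] [Fintype ι] (B : E →L[ℝ] E)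
    (hB : ‖B‖ ≤ 1 / 2) (b : OrthonormalBasis ι ℝ E) :
    |(ContinuousLinearMap.id ℝ E + B).det| ≠ 0 ∧
    ∑ i, inner ℝ (b i) (B (b i)) - ∑ i, ‖B (b i)‖ ^ 2 ≤
      Real.log |(ContinuousLinearMap.id ℝ E + B).det| := by
  obtain ⟨v, hv⟩ := exists_orthonormalBasis_abs_det_eq_prod
    ((ContinuousLinearMap.id ℝ E + B : E →L[ℝ] E) : E →ₗ[ℝ] E)
  change |(ContinuousLinearMap.id ℝ E + B).det| = _ at hv
  have hv1 : ∀ i, ‖v i‖ = 1 := fun i => v.orthonormal.1 i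
  have hσ : ∀ i, 1 / 2 ≤ ‖v i + B (v i)‖ := by
    intro i
    have h1 : ‖B (v i)‖ ≤ 1 / 2 := (B.le_opNorm _).trans (by rw [hv1, mul_one]; exact hB)
    have h2 := norm_sub_norm_le (v i) (-(B (v i)))
    rw [norm_neg, sub_neg_eq_add, hv1] at h2
    linarith
  have happ : ∀ i, ((ContinuousLinearMap.id ℝ E + B : E →L[ℝ] E) : E →ₗ[ℝ] E) (v i)
      = v i + B (v i) := fun i => rfl
  simp_rw [happ] at hv
  rw [hv]
  have hne : ∀ i, ‖v i + B (v i)‖ ≠ 0 := fun i => by have := hσ i; linarith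
  refine ⟨Finset.prod_ne_zero_iff.2 fun i _ => hne i, ?_⟩
  rw [Real.log_prod fun i _ => hne i]
  have ht : ∑ i, inner ℝ (b i) (B (b i)) = ∑ i, inner ℝ (v i) (B (v i)) := by
    have h1 := LinearMap.trace_eq_sum_inner (B : E →ₗ[ℝ] E) b
    have h2 := LinearMap.trace_eq_sum_inner (B : E →ₗ[ℝ] E) v
    exact h1.symm.trans h2
  have hn : ∑ i, ‖B (b i)‖ ^ 2 = ∑ i, ‖B (v i)‖ ^ 2 :=
    (trace_adjoint_comp_self_eq_sum (B : E →ₗ[ℝ] E) b).symm.trans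
      (trace_adjoint_comp_self_eq_sum (B : E →ₗ[ℝ] E) v)
  rw [ht, hn, ← Finset.sum_sub_distrib]
  refine Finset.sum_le_sum fun i _ => le_trans ?_ (three_mul_sub_two_sub_sq_le_log (hσ i))
  have h1 : 1 + inner ℝ (v i) (B (v i)) ≤ ‖v i + B (v i)‖ := by
    have := real_inner_le_norm (v i) (v i + B (v i))
    rwa [inner_add_right, real_inner_self_eq_norm_sq, hv1, one_pow, one_mul] at this
  have h2 := norm_add_sq_real (v i) (B (v i))
  rw [hv1] at h2
  linarith

/-! ### Functions with Lipschitz gradient -/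

/-- The quadratic lower bound for a function whose gradient is `L`-Lipschitz. -/
lemma add_inner_gradient_sub_le {E : Type*} [NormedAddCommGroup E] [InnerProductSpace ℝ E]
    [CompleteSpace E] {f : E → ℝ} (hf : Differentiable ℝ f) {L : ℝ≥0}
    (hL : LipschitzWith L (gradient f)) (x v : E) :
    f x + inner ℝ (gradient f x) v - L / 2 * ‖v‖ ^ 2 ≤ f (x + v) := by
  have hd : ∀ t : ℝ, HasDerivAt
      (fun t : ℝ => f (x + t • v) - t * inner ℝ (gradient f x) v + L / 2 * t ^ 2 * ‖v‖ ^ 2)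
      (inner ℝ (gradient f (x + t • v)) v - inner ℝ (gradient f x) v + L * t * ‖v‖ ^ 2) t := by
    intro t
    have h1 : HasDerivAt (fun t : ℝ => x + t • v) v t := by
      simpa using ((hasDerivAt_id t).smul_const v).const_add x
    have h2 := (hf (x + t • v)).hasGradientAt.hasFDerivAt.comp_hasDerivAt t h1
    have h3 := (hasDerivAt_id t).mul_const (inner ℝ (gradient f x) v)
    have h4 := ((((hasDerivAt_id t).pow 2).const_mul ((L : ℝ) / 2)).mul_const (‖v‖ ^ 2))
    refine ((h2.sub h3).add h4).congr_deriv ?_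
    simp only [InnerProductSpace.toDual_apply_apply, Nat.cast_ofNat, id_eq, one_mul, mul_one]
    ring
  have hmono : MonotoneOn
      (fun t : ℝ => f (x + t • v) - t * inner ℝ (gradient f x) v + L / 2 * t ^ 2 * ‖v‖ ^ 2)
      (Set.Icc 0 1) := by
    apply monotoneOn_of_deriv_nonneg (convex_Icc _ _)
    · exact fun t _ => (hd t).continuousAt.continuousWithinAt
    · exact fun t _ => (hd t).differentiableAt.differentiableWithinAt
    · intro t ht
      rw [interior_Icc] at ht
      rw [(hd t).deriv, ← inner_sub_left]
      have h1 : ‖gradient f (x + t • v) - gradient f x‖ ≤ L * (t * ‖v‖) := by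
        have := hL.dist_le_mul (x + t • v) x
        rwa [dist_eq_norm, dist_eq_norm, add_sub_cancel_left, norm_smul, Real.norm_eq_abs,
          abs_of_pos ht.1] at this
      have h2 := abs_le.1 (abs_real_inner_le_norm (gradient f (x + t • v) - gradient f x) v)
      nlinarith [mul_le_mul_of_nonneg_right h1 (norm_nonneg v)]
  have h := hmono (Set.left_mem_Icc.2 zero_le_one) (Set.right_mem_Icc.2 zero_le_one) zero_le_one
  simp only [zero_smul, add_zero, one_smul, zero_mul, sub_zero, one_mul, one_pow, mul_one,
    ne_eq, OfNat.ofNat_ne_zero, not_false_eq_true, zero_pow, mul_zero] at h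
  linarith

/-! ### Differentiability of feature maps -/

open Filter Topology in
/-- The second difference of a `C²` function `F` on `E × E` around `(x, x)` is, up to
`o(‖u‖ ‖v‖)`, its mixed second derivative `D²F(x, x)((0, v), (u, 0))`. -/
lemma exists_second_difference_sub_le {E : Type*} [NormedAddCommGroup E] [NormedSpace ℝ E]
    {F : E × E → ℝ} (hF : ContDiff ℝ 2 F) (x : E) {ε : ℝ} (hε : 0 < ε) :
    ∃ δ > 0, ∀ u v : E, ‖u‖ < δ → ‖v‖ < δ →
      |F (x + u, x + v) - F (x + u, x) - (F (x, x + v) - F (x, x))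
        - fderiv ℝ (fderiv ℝ F) (x, x) (0, v) (u, 0)| ≤ ε * ‖v‖ * ‖u‖ := by
  have hF1 : ContDiff ℝ 1 (fderiv ℝ F) := hF.fderiv_right (by norm_num)
  have hFd : Differentiable ℝ F := hF.differentiable (by norm_num)
  have hs : HasStrictFDerivAt (fderiv ℝ F) (fderiv ℝ (fderiv ℝ F) (x, x)) (x, x) :=
    hF1.contDiffAt.hasStrictFDerivAt (by norm_num)
  have hb := hs.isLittleO.def hε
  rw [nhds_prod_eq, Metric.nhds_basis_ball.prod_self.eventually_iff] at hb
  obtain ⟨δ, hδ, hb⟩ := hb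
  refine ⟨δ, hδ, fun u v hu hv => ?_⟩
  set A := fderiv ℝ (fderiv ℝ F) (x, x) with hA
  have hmv := (convex_ball x δ).norm_image_sub_le_of_norm_hasFDerivWithin_le
    (f := fun a => F (a, x + v) - F (a, x) - A (0, v) (a, 0))
    (f' := fun a => (fderiv ℝ F (a, x + v) - fderiv ℝ F (a, x) - A (0, v)).comp
      (ContinuousLinearMap.inl ℝ E E)) (C := ε * ‖v‖) (x := x) (y := x + u) ?_ ?_
      (Metric.mem_ball_self hδ) (by simpa using hu)
  · rw [add_sub_cancel_left, Real.norm_eq_abs] at hmv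
    refine le_trans (le_of_eq ?_) hmv
    have : A (0, v) (x + u, 0) = A (0, v) (x, 0) + A (0, v) (u, 0) := by
      rw [← map_add]; simp
    rw [this]
    congr 1
    ring
  · intro a _
    have h1 : ∀ y : E, HasFDerivAt (fun a : E => (a, y)) (ContinuousLinearMap.inl ℝ E E) a :=
      fun y => hasFDerivAt_prodMk_left a y
    have h2 := (hFd (a, x + v)).hasFDerivAt.comp a (h1 (x + v))
    have h3 := (hFd (a, x)).hasFDerivAt.comp a (h1 x)
    have h4 := (A (0, v)).hasFDerivAt.comp a (h1 0)
    exact ((h2.sub h3).sub h4).hasFDerivWithinAt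
  · intro a ha
    have h := @hb ((a, x + v), (a, x)) (by
      simp only [Metric.mem_ball] at ha
      simp [Prod.dist_eq, ha, hv])
    have h0 : ((a, x + v) : E × E) - (a, x) = (0, v) := by simp
    simp only [h0] at h
    have hn : ‖((0 : E), v)‖ = ‖v‖ := by simp [Prod.norm_def]
    rw [hn] at h
    exact (ContinuousLinearMap.opNorm_comp_le _ _).trans
      ((mul_le_of_le_one_right (norm_nonneg _) (ContinuousLinearMap.norm_inl_le_one ℝ E E)).trans h)

open Filter Topology in
/-- A map into a Hilbert space whose Gram kernel is `C²` is differentiable. The difference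
quotients have inner products converging to a bilinear form `G`; so they are Cauchy, their limit
is linear in the direction, and they converge uniformly in the direction. -/
theorem differentiableAt_of_contDiff_inner {E H : Type*} [NormedAddCommGroup E] [NormedSpace ℝ E]
    [FiniteDimensional ℝ E] [NormedAddCommGroup H] [InnerProductSpace ℝ H] [CompleteSpace H]
    {k : E → H} (hF : ContDiff ℝ 2 (fun z : E × E => inner ℝ (k z.1) (k z.2))) (x : E) :
    DifferentiableAt ℝ k x := by
  set F : E × E → ℝ := fun z => inner ℝ (k z.1) (k z.2) with hFdef
  set A := fderiv ℝ (fderiv ℝ F) (x, x) with hA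
  -- the bilinear form of mixed second derivatives
  set G : E → E → ℝ := fun u v => A (0, v) (u, 0) with hG
  have hGaddl : ∀ u u' v, G (u + u') v = G u v + G u' v := by
    intro u u' v
    simp only [hG]; rw [← map_add]; simp
  have hGaddr : ∀ u v v', G u (v + v') = G u v + G u v' := by
    intro u v v'
    simp only [hG]
    rw [show ((0 : E), v + v') = (0, v) + (0, v') by simp, map_add, add_apply]
  have hGsmull : ∀ (c : ℝ) u v, G (c • u) v = c * G u v := by
    intro c u v
    simp only [hG]
    rw [show ((c • u : E), (0 : E)) = c • (u, 0) by simp, map_smul, smul_eq_mul]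
  have hGsmulr : ∀ (c : ℝ) u v, G u (c • v) = c * G u v := by
    intro c u v
    simp only [hG]
    rw [show ((0 : E), (c • v : E)) = c • (0, v) by simp, map_smul,
      smul_apply, smul_eq_mul]
  -- difference quotients
  set Q : ℝ → E → H := fun t u => t⁻¹ • (k (x + t • u) - k x) with hQ
  have hinner : ∀ ε > 0, ∃ δ > 0, ∀ (s t : ℝ) (u v : E), 0 < s → 0 < t → ‖s • u‖ < δ →
      ‖t • v‖ < δ → |inner ℝ (Q s u) (Q t v) - G u v| ≤ ε * ‖v‖ * ‖u‖ := by
    intro ε hε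
    obtain ⟨δ, hδ, h⟩ := exists_second_difference_sub_le hF x hε
    refine ⟨δ, hδ, fun s t u v hs ht hu hv => ?_⟩
    have h := h (s • u) (t • v) hu hv
    have e1 : F (x + s • u, x + t • v) - F (x + s • u, x) - (F (x, x + t • v) - F (x, x))
        = inner ℝ (k (x + s • u) - k x) (k (x + t • v) - k x) := by
      simp only [hFdef, inner_sub_left, inner_sub_right]
      ring
    have e2 : fderiv ℝ (fderiv ℝ F) (x, x) (0, t • v) (s • u, 0) = s * t * G u v := by
      change G (s • u) (t • v) = _
      rw [hGsmull, hGsmulr]; ring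
    rw [e1, e2, norm_smul, norm_smul, Real.norm_of_nonneg hs.le, Real.norm_of_nonneg ht.le] at h
    have e3 : inner ℝ (Q s u) (Q t v) - G u v = (s * t)⁻¹ *
        (inner ℝ (k (x + s • u) - k x) (k (x + t • v) - k x) - s * t * G u v) := by
      simp only [hQ, inner_smul_left, inner_smul_right, RCLike.conj_to_real]
      field_simp
    rw [e3, abs_mul, abs_of_pos (by positivity)]
    calc _ ≤ (s * t)⁻¹ * (ε * (t * ‖v‖) * (s * ‖u‖)) := by gcongr
      _ = _ := by field_simp
  have hdist : ∀ ε > 0, ∃ δ > 0, ∀ (s t : ℝ) (u : E), 0 < s → 0 < t → ‖s • u‖ < δ →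
      ‖t • u‖ < δ → ‖Q s u - Q t u‖ ≤ ε * ‖u‖ := by
    intro ε hε
    obtain ⟨δ, hδ, h⟩ := hinner (ε ^ 2 / 4) (by positivity)
    refine ⟨δ, hδ, fun s t u hs ht hsu htu => ?_⟩
    have h1 := abs_le.1 (h s s u u hs hs hsu hsu)
    have h2 := abs_le.1 (h s t u u hs ht hsu htu)
    have h3 := abs_le.1 (h t t u u ht ht htu htu)
    rw [real_inner_self_eq_norm_sq] at h1 h3
    refine abs_le_of_sq_le_sq' ?_ (by positivity) |>.2
    rw [norm_sub_sq_real, mul_pow]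
    nlinarith
  -- directional derivatives along the step sizes `1 / (n + 1)`
  set τ : ℕ → ℝ := fun n => 1 / ((n : ℝ) + 1) with hτ
  have hτpos : ∀ n, 0 < τ n := fun n => by simp only [hτ]; positivity
  have hτ0 : Tendsto τ atTop (𝓝 0) := tendsto_one_div_add_atTop_nhds_zero_nat
  have hτsmall : ∀ (u : E) (δ : ℝ), 0 < δ → ∀ᶠ n in atTop, ‖τ n • u‖ < δ := by
    intro u δ hδ
    have : Tendsto (fun n => ‖τ n • u‖) atTop (𝓝 0) := by
      simpa using (hτ0.smul_const u).norm
    exact this.eventually (gt_mem_nhds hδ)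
  have hcauchy : ∀ u, CauchySeq fun n => Q (τ n) u := by
    intro u
    rw [Metric.cauchySeq_iff']
    intro ε hε
    obtain ⟨δ, hδ, h⟩ := hdist (ε / (‖u‖ + 1)) (by positivity)
    obtain ⟨N, hN⟩ := eventually_atTop.1 (hτsmall u δ hδ)
    refine ⟨N, fun n hn => ?_⟩
    rw [dist_eq_norm]
    refine (h _ _ u (hτpos n) (hτpos N) (hN n hn) (hN N le_rfl)).trans_lt ?_
    rw [div_mul_eq_mul_div, div_lt_iff₀ (by positivity)]
    nlinarith [norm_nonneg u]
  choose D hD using fun u => cauchySeq_tendsto_of_complete (hcauchy u)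
  have hDinner : ∀ u v, inner ℝ (D u) (D v) = G u v := by
    intro u v
    refine tendsto_nhds_unique ((hD u).inner (hD v)) ?_
    rw [Metric.tendsto_atTop]
    intro ε hε
    obtain ⟨δ, hδ, h⟩ := hinner (ε / (‖v‖ * ‖u‖ + 1)) (by positivity)
    obtain ⟨N, hN⟩ := eventually_atTop.1 ((hτsmall u δ hδ).and (hτsmall v δ hδ))
    refine ⟨N, fun n hn => ?_⟩
    rw [Real.dist_eq]
    refine (h _ _ u v (hτpos n) (hτpos n) (hN n hn).1 (hN n hn).2).trans_lt ?_
    rw [mul_assoc, div_mul_eq_mul_div, div_lt_iff₀ (by positivity)]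
    nlinarith
  let D' : E →ₗ[ℝ] H :=
    { toFun := D
      map_add' := fun u v => by
        rw [← sub_eq_zero, ← norm_eq_zero, ← sq_eq_zero_iff, ← real_inner_self_eq_norm_sq]
        simp only [inner_sub_left, inner_sub_right, inner_add_left, inner_add_right, hDinner,
          hGaddl, hGaddr]
        ring
      map_smul' := fun c u => by
        rw [← sub_eq_zero, ← norm_eq_zero, ← sq_eq_zero_iff, ← real_inner_self_eq_norm_sq]
        simp only [RingHom.id_apply, inner_sub_left, inner_sub_right, inner_smul_left,
          inner_smul_right, RCLike.conj_to_real, hDinner, hGsmull, hGsmulr]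
        ring }
  have hderiv : HasFDerivAt k (LinearMap.toContinuousLinearMap D') x := by
    rw [hasFDerivAt_iff_isLittleO_nhds_zero, Asymptotics.isLittleO_iff]
    intro ε hε
    obtain ⟨δ, hδ, h⟩ := hdist ε hε
    filter_upwards [Metric.ball_mem_nhds (0 : E) hδ] with u hu
    rw [mem_ball_zero_iff] at hu
    have hlim : Tendsto (fun n => ‖Q 1 u - Q (τ n) u‖) atTop (𝓝 ‖Q 1 u - D u‖) :=
      ((hD u).const_sub _).norm
    have hle : ‖Q 1 u - D u‖ ≤ ε * ‖u‖ := by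
      refine le_of_tendsto hlim ?_
      filter_upwards [hτsmall u δ hδ] with n hn
      exact h 1 (τ n) u one_pos (hτpos n) (by simpa using hu) hn
    simpa [hQ, D'] using hle
  exact hderiv.differentiableAt

/-! ### Weak integrals in a Hilbert space -/

open Filter Topology in
/-- If `x ↦ ⟪ξ x, f⟫` is integrable for every `f` in the Hilbert space `V`, then these integrals
are represented by a vector of `V`: by the closed graph theorem `f ↦ ⟪ξ ·, f⟫` is a bounded
map into `L¹`. -/
theorem exists_forall_integral_inner_eq_inner {α V : Type*} [MeasurableSpace α] (q : Measure α)
    [NormedAddCommGroup V] [InnerProductSpace ℝ V] [CompleteSpace V] (ξ : α → V)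
    (hξ : ∀ f : V, Integrable (fun x => inner ℝ (ξ x) f) q) :
    ∃ g : V, ∀ f : V, ∫ x, inner ℝ (ξ x) f ∂q = inner ℝ g f := by
  let A : V →ₗ[ℝ] (α →₁[q] ℝ) :=
    { toFun := fun f => (hξ f).toL1 _
      map_add' := fun f f' => by
        rw [← Integrable.toL1_add, Integrable.toL1_eq_toL1_iff]
        exact Eventually.of_forall fun x => inner_add_right _ _ _
      map_smul' := fun c f => by
        rw [RingHom.id_apply, ← Integrable.toL1_smul, Integrable.toL1_eq_toL1_iff]
        exact Eventually.of_forall fun x => inner_smul_right _ _ _ }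
  have hA : Continuous A := by
    refine LinearMap.continuous_of_seq_closed_graph A fun u f y hu hy => ?_
    obtain ⟨ns, hns, hae⟩ := (tendstoInMeasure_of_tendsto_Lp hy).exists_seq_tendsto_ae
    refine Lp.ext ?_
    have hall : ∀ᵐ x ∂q, ∀ n, (A (u n) : α → ℝ) x = inner ℝ (ξ x) (u n) :=
      ae_all_iff.2 fun n => (hξ (u n)).coeFn_toL1
    filter_upwards [hae, hall, (hξ f).coeFn_toL1] with x h1 h2 h3
    change _ = ((hξ f).toL1 _ : α → ℝ) x
    rw [h3]
    refine tendsto_nhds_unique h1 ?_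
    have : Tendsto (fun n => inner ℝ (ξ x) (u (ns n))) atTop (𝓝 (inner ℝ (ξ x) f)) :=
      tendsto_const_nhds.inner (hu.comp hns.tendsto_atTop)
    exact this.congr fun n => (h2 (ns n)).symm
  let φ : V →L[ℝ] ℝ := (L1.integralCLM (α := α) (E := ℝ) (μ := q)).comp ⟨A, hA⟩
  refine ⟨(InnerProductSpace.toDual ℝ V).symm φ, fun f => ?_⟩
  rw [InnerProductSpace.toDual_symm_apply]
  change _ = L1.integralCLM ((hξ f).toL1 _)
  rw [integral_eq _ (hξ f), L1.integral_eq]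

/-! ### Kullback–Leibler divergence under a change of variables -/

open Filter in
/-- The divergence of `q` from `μ`, when `T` transports the measure `e ^ r μ` to `μ`. Since
`KL(T_* q ‖ μ) = KL(q ‖ e ^ r μ)`, a lower bound `ℓ ≤ r` suffices; `r` itself need not be
assumed integrable. -/
theorem klDiv_map_ne_top_and_sub_le {α : Type*} [MeasurableSpace α] {q μ : Measure α}
    [IsFiniteMeasure q] [IsFiniteMeasure μ] {T : α → α} (hT : MeasurableEmbedding T)
    {r ℓ : α → ℝ} (hr : Measurable r)
    (hmap : (μ.withDensity fun x => ENNReal.ofReal (Real.exp (r x))).map T = μ)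
    (hℓ : Integrable ℓ q) (hle : ∀ x, ℓ x ≤ r x) (hkl : klDiv q μ ≠ ∞) :
    klDiv (q.map T) μ ≠ ∞ ∧
      (klDiv (q.map T) μ).toReal - (klDiv q μ).toReal ≤ - ∫ x, ℓ x ∂q := by
  obtain ⟨hac, hint⟩ := klDiv_ne_top_iff.1 hkl
  set w : α → ℝ≥0∞ := fun x => ENNReal.ofReal (Real.exp (r x)) with hw
  have hwm : Measurable w := (Real.measurable_exp.comp hr).ennreal_ofReal
  have hw0 : ∀ x, w x ≠ 0 := fun x => by simp [hw, Real.exp_pos]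
  have hwtop : ∀ x, w x ≠ ∞ := fun x => ENNReal.ofReal_ne_top
  set ν := μ.withDensity w with hν
  have hνfin : IsFiniteMeasure ν := by
    refine ⟨?_⟩
    have : ν Set.univ = μ Set.univ := by
      conv_rhs => rw [← hmap]
      rw [Measure.map_apply hT.measurable MeasurableSet.univ, Set.preimage_univ]
    rw [this]; exact measure_lt_top _ _
  have hμν : μ ≪ ν := withDensity_absolutelyContinuous' hwm.aemeasurable
    (Eventually.of_forall hw0)
  have hqν : q ≪ ν := hac.trans hμν
  -- the two log-likelihood ratios differ by `r`
  have hllr : llr q ν =ᵐ[q] fun x => llr q μ x - r x := by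
    have h := Measure.rnDeriv_withDensity_right q μ hwm.aemeasurable
      (Eventually.of_forall hw0) (Eventually.of_forall hwtop)
    filter_upwards [hac h, Measure.rnDeriv_pos hac, hac (Measure.rnDeriv_ne_top q μ)]
      with x hx hpos htop
    rw [llr, llr, hx, ENNReal.toReal_mul, ENNReal.toReal_inv, hw,
      ENNReal.toReal_ofReal (Real.exp_pos _).le, Real.log_mul (by positivity)
        (ENNReal.toReal_pos hpos.ne' htop).ne', Real.log_inv, Real.log_exp]
    ring
  have hub : llr q ν ≤ᵐ[q] fun x => llr q μ x - ℓ x := by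
    filter_upwards [hllr] with x hx
    rw [hx]; linarith [hle x]
  have hlb : (fun x => 1 - (ν.rnDeriv q x).toReal) ≤ᵐ[q] llr q ν := by
    filter_upwards [exp_neg_llr hqν] with x hx
    rw [← hx]
    linarith [Real.add_one_le_exp (-llr q ν x)]
  have hintν : Integrable (llr q ν) q :=
    integrable_of_le_of_le (measurable_llr q ν).aestronglyMeasurable hlb hub
      ((integrable_const 1).sub Measure.integrable_toReal_rnDeriv) (hint.sub hℓ)
  -- transport by `T`
  have hacT : q.map T ≪ μ := by
    conv_rhs => rw [← hmap]
    exact hqν.map hT.measurable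
  have hllrT : (fun x => llr (q.map T) μ (T x)) =ᵐ[q] llr q ν := by
    have h := hqν (hT.rnDeriv_map q ν)
    rw [hmap] at h
    filter_upwards [h] with x hx
    rw [llr, llr, hx]
  have hintT : Integrable (llr (q.map T) μ) (q.map T) := by
    rw [hT.integrable_map_iff]
    exact hintν.congr hllrT.symm
  refine ⟨klDiv_ne_top hacT hintT, ?_⟩
  have huniv : (q.map T).real Set.univ = q.real Set.univ := by
    simp [Measure.real, Measure.map_apply hT.measurable MeasurableSet.univ]
  have hIT : ∫ x, llr (q.map T) μ x ∂(q.map T) = ∫ x, llr q ν x ∂q := by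
    rw [hT.integral_map]; exact integral_congr_ae hllrT
  have hI : ∫ x, llr q ν x ∂q ≤ ∫ x, llr q μ x ∂q - ∫ x, ℓ x ∂q := by
    rw [← integral_sub hint hℓ]
    exact integral_mono_ae hintν (hint.sub hℓ) hub
  rw [toReal_klDiv hacT hintT, toReal_klDiv hac hint, huniv, hIT]
  linarith

/-! ### Small perturbations of the identity -/

/-- If `‖Dψ‖ ≤ 1/2` everywhere, then `x ↦ x + ψ x` is a bijection. -/
lemma bijective_id_add_of_norm_fderiv_le {E : Type*} [NormedAddCommGroup E] [NormedSpace ℝ E]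
    [CompleteSpace E] {ψ : E → E} (hψ : Differentiable ℝ ψ) (hb : ∀ x, ‖fderiv ℝ ψ x‖ ≤ 1 / 2) :
    Function.Bijective fun x => x + ψ x := by
  have hlip : LipschitzWith (1 / 2) ψ :=
    lipschitzWith_of_nnnorm_fderiv_le hψ fun x => by
      rw [← NNReal.coe_le_coe]; simpa using hb x
  have happ : ApproximatesLinearOn (fun x => x + ψ x)
      ((ContinuousLinearEquiv.refl ℝ E : E ≃L[ℝ] E) : E →L[ℝ] E) Set.univ (1 / 2) := by
    intro x _ y _
    have h := hlip.dist_le_mul x y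
    rw [dist_eq_norm, dist_eq_norm] at h
    refine le_trans (le_of_eq ?_) h
    congr 1
    simp only [ContinuousLinearEquiv.coe_refl, ContinuousLinearMap.coe_id', id_eq]
    abel
  have hc : Subsingleton E ∨ (1 / 2 : ℝ≥0) <
      ‖((ContinuousLinearEquiv.refl ℝ E).symm : E →L[ℝ] E)‖₊⁻¹ := by
    rcases subsingleton_or_nontrivial E with h | h
    · exact Or.inl h
    · right
      have : ‖((ContinuousLinearEquiv.refl ℝ E).symm : E →L[ℝ] E)‖₊ = 1 :=
        NNReal.eq ContinuousLinearMap.norm_id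
      rw [this, inv_one]
      exact NNReal.half_lt_self one_ne_zero
  exact ⟨Set.injOn_univ.1 (happ.injOn hc), happ.surjective hc⟩

/-- The change of variables formula for the density `p`: `T` pushes
`p ∘ T · |det DT|` to `p`, written with `p ∘ T · |det DT| = e ^ r p`. -/
lemma map_withDensity_exp_targetMeasure {d : ℕ} {p : EuclideanSpace ℝ (Fin d) → ℝ}
    (hp_pos : ∀ x, 0 < p x) (hp : Measurable p)
    {T : EuclideanSpace ℝ (Fin d) → EuclideanSpace ℝ (Fin d)} (hT : Differentiable ℝ T)
    (hbij : Function.Bijective T) (hdet : ∀ x, |(fderiv ℝ T x).det| ≠ 0)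
    (hr : Measurable fun x => Real.log (p (T x)) - Real.log (p x)
      + Real.log |(fderiv ℝ T x).det|) :
    ((targetMeasure p).withDensity fun x => ENNReal.ofReal (Real.exp
      (Real.log (p (T x)) - Real.log (p x) + Real.log |(fderiv ℝ T x).det|))).map T
      = targetMeasure p := by
  have hTm : Measurable T := hT.continuous.measurable
  ext s hs
  have hs' : MeasurableSet (T ⁻¹' s) := hTm hs
  have hwm : Measurable fun x => ENNReal.ofReal (Real.exp
      (Real.log (p (T x)) - Real.log (p x) + Real.log |(fderiv ℝ T x).det|)) :=
    (Real.measurable_exp.comp hr).ennreal_ofReal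
  rw [Measure.map_apply hTm hs, targetMeasure, withDensity_apply _ hs', withDensity_apply _ hs,
    setLIntegral_withDensity_eq_setLIntegral_mul _ hp.ennreal_ofReal hwm hs']
  conv_rhs => rw [← Set.image_preimage_eq s hbij.2]
  rw [lintegral_image_eq_lintegral_abs_det_fderiv_mul volume hs'
    (fun x _ => (hT x).hasFDerivAt.hasFDerivWithinAt) hbij.1.injOn]
  refine lintegral_congr fun x => ?_
  rw [Pi.mul_apply, ← ENNReal.ofReal_mul (hp_pos x).le, ← ENNReal.ofReal_mul (abs_nonneg _)]
  congr 1
  rw [Real.exp_add, Real.exp_sub, Real.exp_log (hp_pos _), Real.exp_log (hp_pos _),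
    Real.exp_log (lt_of_le_of_ne (abs_nonneg _) (hdet x).symm)]
  have := (hp_pos x).ne'
  field_simp

/-! ### The Stein operator on a reproducing kernel Hilbert space -/

lemma sum_sq_inner_le {d : ℕ} {H : Type*} [NormedAddCommGroup H] [InnerProductSpace ℝ H]
    (g : PiLp 2 (fun _ : Fin d => H)) (h : H) :
    ∑ i, (inner ℝ h (g i)) ^ 2 ≤ ‖g‖ ^ 2 * ‖h‖ ^ 2 := by
  rw [PiLp.norm_sq_eq_of_L2, Finset.sum_mul]
  refine Finset.sum_le_sum fun i _ => ?_
  rw [← sq_abs, ← mul_pow, mul_comm]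
  exact pow_le_pow_left₀ (abs_nonneg _) (abs_real_inner_le_norm _ _) 2

section FeatureMap

/-- The canonical feature map `x ↦ κ(x, ·)` of a reproducing kernel Hilbert space of real
functions. -/
noncomputable def featureMap {d : ℕ} (H : Type*) [NormedAddCommGroup H] [InnerProductSpace ℝ H]
    [CompleteSpace H] [RKHS ℝ H (EuclideanSpace ℝ (Fin d)) ℝ] (x : EuclideanSpace ℝ (Fin d)) : H :=
  RKHS.kerFun H x 1

/-- The vector `ξ_x` of `H^d` that represents the Stein functional `φ ↦ trace (A_p φ (x))`; its
components are `s_i(x) κ(x, ·) + ∂_{x_i} κ(x, ·)` with `s` the score. -/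
noncomputable def steinFeature {d : ℕ} (H : Type*) [NormedAddCommGroup H] [InnerProductSpace ℝ H]
    [CompleteSpace H] [RKHS ℝ H (EuclideanSpace ℝ (Fin d)) ℝ] (p : EuclideanSpace ℝ (Fin d) → ℝ)
    (x : EuclideanSpace ℝ (Fin d)) : PiLp 2 (fun _ : Fin d => H) :=
  WithLp.toLp 2 fun i => score p x i • featureMap H x
    + fderiv ℝ (featureMap H) x (EuclideanSpace.single i 1)

variable {d : ℕ} {H : Type*} [NormedAddCommGroup H] [InnerProductSpace ℝ H] [CompleteSpace H]
  [RKHS ℝ H (EuclideanSpace ℝ (Fin d)) ℝ] {p : EuclideanSpace ℝ (Fin d) → ℝ}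
  {κ : EuclideanSpace ℝ (Fin d) → EuclideanSpace ℝ (Fin d) → ℝ}

lemma inner_featureMap (x : EuclideanSpace ℝ (Fin d)) (f : H) :
    inner ℝ (featureMap H x) f = f x := by
  rw [featureMap, RKHS.kerFun_inner]
  simp

lemma inner_featureMap_featureMap (hκ : ∀ x y, RKHS.kernel H x y 1 = κ x y)
    (x y : EuclideanSpace ℝ (Fin d)) : inner ℝ (featureMap H x) (featureMap H y) = κ x y := by
  rw [inner_featureMap, ← hκ, featureMap, RKHS.kerFun_apply]

lemma differentiable_featureMap (hκ : ∀ x y, RKHS.kernel H x y 1 = κ x y)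
    (hκ_C2 : ContDiff ℝ 2 (fun z : EuclideanSpace ℝ (Fin d) × EuclideanSpace ℝ (Fin d) =>
      κ z.1 z.2)) : Differentiable ℝ (featureMap H (d := d)) := by
  refine fun x => differentiableAt_of_contDiff_inner ?_ x
  simpa only [inner_featureMap_featureMap hκ] using hκ_C2

/-- Elements of `H^d` are differentiable vector fields, with derivative read off from that of the
feature map. -/
lemma differentiableAt_rkhsField_and_fderiv_apply (hk : Differentiable ℝ (featureMap H (d := d)))
    (f : PiLp 2 (fun _ : Fin d => H)) (x : EuclideanSpace ℝ (Fin d)) :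
    DifferentiableAt ℝ (rkhsField H f) x ∧ ∀ v i,
      fderiv ℝ (rkhsField H f) x v i = inner ℝ (fderiv ℝ (featureMap H) x v) (f i) := by
  have hi : ∀ i, HasFDerivAt (fun y => rkhsField H f y i)
      ((innerSL ℝ (f i)).comp (fderiv ℝ (featureMap H) x)) x := by
    intro i
    have h := (innerSL ℝ (f i)).hasFDerivAt.comp x (hk x).hasFDerivAt
    refine h.congr_of_eventuallyEq (Filter.Eventually.of_forall fun y => ?_)
    simp only [Function.comp_apply, innerSL_apply_apply]
    rw [real_inner_comm, inner_featureMap]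
    rfl
  have hd : DifferentiableAt ℝ (rkhsField H f) x :=
    (differentiableAt_euclidean).2 fun i => (hi i).differentiableAt
  refine ⟨hd, fun v i => ?_⟩
  have h := ((EuclideanSpace.proj (𝕜 := ℝ) i).hasFDerivAt.comp x hd.hasFDerivAt).unique (hi i)
  have h2 := congrArg (fun A => A v) h
  simp only [ContinuousLinearMap.comp_apply, innerSL_apply_apply] at h2
  rw [real_inner_comm, ← h2]
  rfl

lemma trace_steinOperator_rkhsField (hk : Differentiable ℝ (featureMap H (d := d)))
    (f : PiLp 2 (fun _ : Fin d => H)) (x : EuclideanSpace ℝ (Fin d)) :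
    (steinOperator p (rkhsField H f) x).trace = inner ℝ (steinFeature H p x) f := by
  rw [PiLp.inner_apply, Matrix.trace]
  refine Finset.sum_congr rfl fun i _ => ?_
  rw [Matrix.diag_apply, steinOperator, Matrix.of_apply,
    (differentiableAt_rkhsField_and_fderiv_apply hk f x).2]
  simp only [steinFeature, inner_add_left, inner_smul_left, RCLike.conj_to_real, inner_featureMap]
  rw [mul_comm]
  rfl

lemma mixedDerivative_eq_sum_norm_sq (hκ : ∀ x y, RKHS.kernel H x y 1 = κ x y)
    (hk : Differentiable ℝ (featureMap H (d := d))) (x : EuclideanSpace ℝ (Fin d)) :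
    mixedDerivative κ x
      = ∑ j : Fin d, ‖fderiv ℝ (featureMap H) x (EuclideanSpace.single j 1)‖ ^ 2 := by
  refine Finset.sum_congr rfl fun j _ => ?_
  have h1 : ∀ y, fderiv ℝ (fun z => κ y z) x (EuclideanSpace.single j 1)
      = inner ℝ (fderiv ℝ (featureMap H) x (EuclideanSpace.single j 1)) (featureMap H y) := by
    intro y
    have h := (innerSL ℝ (featureMap H y)).hasFDerivAt.comp x (hk x).hasFDerivAt
    have h' : (fun z => κ y z) = innerSL ℝ (featureMap H y) ∘ featureMap H := by
      ext z; simp [inner_featureMap_featureMap hκ]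
    rw [h', h.fderiv, ContinuousLinearMap.comp_apply, innerSL_apply_apply, real_inner_comm]
  simp_rw [h1]
  have h := (innerSL ℝ (fderiv ℝ (featureMap H) x (EuclideanSpace.single j 1))).hasFDerivAt.comp x
    (hk x).hasFDerivAt
  change fderiv ℝ ((innerSL ℝ (fderiv ℝ (featureMap H) x (EuclideanSpace.single j 1)))
    ∘ featureMap H) x _ = _
  rw [h.fderiv, ContinuousLinearMap.comp_apply, innerSL_apply_apply, real_inner_self_eq_norm_sq]

/-- Pointwise form of the quadratic error term: `L/2 ‖φ‖² + ‖∇φ‖²` (Frobenius norm) at `x` is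
at most `‖φ‖²` (norm of `H^d`) times `L κ(x, x) / 2 + ∇_{x,x'} κ(x, x)`. -/
lemma quadratic_error_le (hκ : ∀ x y, RKHS.kernel H x y 1 = κ x y)
    (hk : Differentiable ℝ (featureMap H (d := d))) (L : ℝ≥0) (g : PiLp 2 (fun _ : Fin d => H))
    (x : EuclideanSpace ℝ (Fin d)) :
    L / 2 * ‖rkhsField H g x‖ ^ 2
      + ∑ j, ‖fderiv ℝ (rkhsField H g) x (EuclideanSpace.single j 1)‖ ^ 2
      ≤ ‖g‖ ^ 2 * stepCost L κ x := by
  have h1 : ‖rkhsField H g x‖ ^ 2 ≤ ‖g‖ ^ 2 * κ x x := by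
    have h := sum_sq_inner_le g (featureMap H x)
    rw [← real_inner_self_eq_norm_sq (featureMap H x), inner_featureMap_featureMap hκ] at h
    refine le_trans (le_of_eq ?_) h
    rw [EuclideanSpace.norm_sq_eq]
    refine Finset.sum_congr rfl fun i _ => ?_
    rw [inner_featureMap, Real.norm_eq_abs, sq_abs]
    rfl
  have h2 : ∑ j, ‖fderiv ℝ (rkhsField H g) x (EuclideanSpace.single j 1)‖ ^ 2
      ≤ ‖g‖ ^ 2 * mixedDerivative κ x := by
    rw [mixedDerivative_eq_sum_norm_sq hκ hk, Finset.mul_sum]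
    refine Finset.sum_le_sum fun j _ => ?_
    refine le_trans (le_of_eq ?_) (sum_sq_inner_le g _)
    rw [EuclideanSpace.norm_sq_eq]
    refine Finset.sum_congr rfl fun i _ => ?_
    rw [(differentiableAt_rkhsField_and_fderiv_apply hk g x).2, Real.norm_eq_abs, sq_abs]
  rw [stepCost]
  have h3 := mul_le_mul_of_nonneg_left h1 (show (0 : ℝ) ≤ L / 2 by positivity)
  linarith

/-- The Stein functional `φ ↦ E_q[trace (A_p φ)]` is represented by a vector `g` of `H^d`; the
SVGD direction is the vector field of `g`, and the discrepancy is `‖g‖`. -/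
theorem exists_svgdDirection_eq_rkhsField (hκ : ∀ x y, RKHS.kernel H x y 1 = κ x y)
    (hk : Differentiable ℝ (featureMap H (d := d))) (q : Measure (EuclideanSpace ℝ (Fin d)))
    (hq : SteinIntegrable H p q) :
    ∃ g : PiLp 2 (fun _ : Fin d => H), svgdDirection p κ q = rkhsField H g ∧
      steinDiscrepancy H q p = ‖g‖ ∧
      ∀ f, ∫ x, (steinOperator p (rkhsField H f) x).trace ∂q = inner ℝ g f := by
  have hq' : ∀ f, Integrable (fun x => inner ℝ (steinFeature H p x) f) q := fun f => by
    simpa only [trace_steinOperator_rkhsField hk] using hq f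
  obtain ⟨g, hg⟩ := exists_forall_integral_inner_eq_inner q (steinFeature H p) hq'
  have hg' : ∀ f, ∫ x, (steinOperator p (rkhsField H f) x).trace ∂q = inner ℝ g f := fun f => by
    simpa only [trace_steinOperator_rkhsField hk] using hg f
  refine ⟨g, ?_, ?_, hg'⟩
  · ext x i
    -- the integrand of the `i`-th component is the Stein feature tested on `κ(x, ·) e_i`
    have hcomp : ∀ y j, (κ x y • score p y + gradient (fun z => κ x z) y) j
        = inner ℝ (steinFeature H p y)
          (WithLp.toLp 2 (Pi.single j (featureMap H x)) : PiLp 2 (fun _ : Fin d => H)) := by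
      intro y j
      have hgrad : gradient (fun z => κ x z) y j
          = inner ℝ (fderiv ℝ (featureMap H) y (EuclideanSpace.single j 1)) (featureMap H x) := by
        have h := (innerSL ℝ (featureMap H x)).hasFDerivAt.comp y (hk y).hasFDerivAt
        have h' : (fun z => κ x z) = innerSL ℝ (featureMap H x) ∘ featureMap H := by
          ext z; simp [inner_featureMap_featureMap hκ]
        have h2 : gradient (fun z => κ x z) y j
            = inner ℝ (gradient (fun z => κ x z) y) (EuclideanSpace.single j 1) := by
          rw [EuclideanSpace.inner_single_right]; simp
        rw [h2, inner_gradient_left, h', h.fderiv, ContinuousLinearMap.comp_apply,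
          innerSL_apply_apply, real_inner_comm]
      rw [PiLp.inner_apply, Finset.sum_eq_single j]
      · simp only [PiLp.add_apply, PiLp.smul_apply, smul_eq_mul, hgrad, Pi.single_eq_same,
          steinFeature, inner_add_left, inner_smul_left, RCLike.conj_to_real,
          inner_featureMap_featureMap hκ]
        rw [← inner_featureMap_featureMap hκ, ← inner_featureMap_featureMap hκ, real_inner_comm,
          mul_comm]
      · intro b _ hb
        simp [Pi.single_eq_of_ne hb]
      · simp
    have hI : ∀ j, Integrable
        (fun y => (κ x y • score p y + gradient (fun z => κ x z) y) j) q := by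
      intro j
      simp_rw [hcomp]
      exact hq' _
    rw [svgdDirection, eval_integral_piLp hI]
    simp_rw [hcomp]
    rw [hg, PiLp.inner_apply, Finset.sum_eq_single i]
    · simp only [Pi.single_eq_same]
      rw [real_inner_comm, inner_featureMap]
      rfl
    · intro b _ hb
      simp [Pi.single_eq_of_ne hb]
    · simp
  · refine IsGreatest.csSup_eq ⟨⟨‖g‖⁻¹ • g, ?_, ?_⟩, ?_⟩
    · rw [norm_smul, norm_inv, norm_norm]
      exact inv_mul_le_one
    · rw [hg', inner_smul_right, real_inner_self_eq_norm_sq]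
      rcases eq_or_ne ‖g‖ 0 with h | h
      · simp [h]
      · field_simp
    · rintro r ⟨f, hf, rfl⟩
      rw [hg']
      exact (real_inner_le_norm g f).trans (mul_le_of_le_one_right (norm_nonneg _) hf)

end FeatureMap

/-! ### The descent inequality -/

/-- Finiteness is all the descent needs, and it holds without measurability of the SVGD maps: a
pushforward along a map that is not a.e.-measurable is the zero measure. -/
lemma isFiniteMeasure_svgdLaw {d : ℕ} (p : EuclideanSpace ℝ (Fin d) → ℝ)
    (κ : EuclideanSpace ℝ (Fin d) → EuclideanSpace ℝ (Fin d) → ℝ) (ε : ℝ)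
    (q₀ : Measure (EuclideanSpace ℝ (Fin d))) [IsFiniteMeasure q₀] (t : ℕ) :
    IsFiniteMeasure (svgdLaw p κ ε q₀ t) := by
  induction t with
  | zero => assumption
  | succ t _ => rw [svgdLaw, svgdStep]; infer_instance

/-- The logarithm of the density ratio created by the step `x ↦ x + ε φ x` is at least its
first-order part `ε trace (A_p φ)` minus a quadratic error. -/
lemma log_density_ratio_ge {d : ℕ} {p : EuclideanSpace ℝ (Fin d) → ℝ}
    (hp : Differentiable ℝ fun x => Real.log (p x)) {L : ℝ≥0} (hp_lip : LipschitzWith L (score p))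
    {φ : EuclideanSpace ℝ (Fin d) → EuclideanSpace ℝ (Fin d)} {ε : ℝ} (hε : 0 < ε)
    (x : EuclideanSpace ℝ (Fin d)) (hφ : DifferentiableAt ℝ φ x)
    (hsmall : ε * ‖fderiv ℝ φ x‖ ≤ 1 / 2) :
    |(fderiv ℝ (fun y => y + ε • φ y) x).det| ≠ 0 ∧
    ε * (steinOperator p φ x).trace - ε ^ 2 * (L / 2 * ‖φ x‖ ^ 2
        + ∑ j, ‖fderiv ℝ φ x (EuclideanSpace.single j 1)‖ ^ 2) ≤
      Real.log (p (x + ε • φ x)) - Real.log (p x)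
        + Real.log |(fderiv ℝ (fun y => y + ε • φ y) x).det| := by
  have hD : fderiv ℝ (fun y => y + ε • φ y) x = ContinuousLinearMap.id ℝ _ + ε • fderiv ℝ φ x :=
    ((hasFDerivAt_id x).add (hφ.hasFDerivAt.const_smul ε)).fderiv
  have hB : ‖ε • fderiv ℝ φ x‖ ≤ 1 / 2 := by
    rwa [norm_smul, Real.norm_of_nonneg hε.le]
  obtain ⟨hdet, hlog⟩ := log_abs_det_one_add_ge (ε • fderiv ℝ φ x) hB
    (EuclideanSpace.basisFun (Fin d) ℝ)
  rw [hD]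
  refine ⟨hdet, ?_⟩
  have hdesc := add_inner_gradient_sub_le hp hp_lip x (ε • φ x)
  change Real.log (p x) + inner ℝ (score p x) (ε • φ x) - _ ≤ _ at hdesc
  have htr : (steinOperator p φ x).trace = inner ℝ (score p x) (φ x)
      + ∑ j, fderiv ℝ φ x (EuclideanSpace.single j 1) j := by
    rw [PiLp.inner_apply, ← Finset.sum_add_distrib]
    rfl
  have h1 : ∑ i, inner ℝ (EuclideanSpace.basisFun (Fin d) ℝ i)
      ((ε • fderiv ℝ φ x) (EuclideanSpace.basisFun (Fin d) ℝ i))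
      = ε * ∑ j, fderiv ℝ φ x (EuclideanSpace.single j 1) j := by
    rw [Finset.mul_sum]
    refine Finset.sum_congr rfl fun i _ => ?_
    simp [EuclideanSpace.inner_single_left]
  have h2 : ∑ i, ‖(ε • fderiv ℝ φ x) (EuclideanSpace.basisFun (Fin d) ℝ i)‖ ^ 2
      = ε ^ 2 * ∑ j, ‖fderiv ℝ φ x (EuclideanSpace.single j 1)‖ ^ 2 := by
    rw [Finset.mul_sum]
    refine Finset.sum_congr rfl fun i _ => ?_
    simp [norm_smul, mul_pow]
  rw [h1, h2] at hlog
  rw [inner_smul_right, norm_smul, mul_pow, Real.norm_of_nonneg hε.le] at hdesc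
  rw [htr]
  linarith

/-- The descent inequality for one SVGD step from a finite measure `q`. -/
theorem klDiv_svgdStep_ne_top_and_sub_le {d : ℕ}
    {p : EuclideanSpace ℝ (Fin d) → ℝ} (hp_pos : ∀ x, 0 < p x) (hp_int : ∫ x, p x = 1)
    (hp_C2 : ContDiff ℝ 2 (fun x => Real.log (p x)))
    {L : ℝ≥0} (hp_lip : LipschitzWith L (score p))
    {κ : EuclideanSpace ℝ (Fin d) → EuclideanSpace ℝ (Fin d) → ℝ}
    (hκ_C2 : ContDiff ℝ 2 (fun z : EuclideanSpace ℝ (Fin d) × EuclideanSpace ℝ (Fin d) =>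
      κ z.1 z.2))
    {H : Type*} [NormedAddCommGroup H] [InnerProductSpace ℝ H] [CompleteSpace H]
    [RKHS ℝ H (EuclideanSpace ℝ (Fin d)) ℝ]
    (hκ : ∀ x y, RKHS.kernel H x y 1 = κ x y)
    (q : Measure (EuclideanSpace ℝ (Fin d))) [IsFiniteMeasure q] {ε : ℝ} (hε : 0 < ε)
    (hcost : Integrable (stepCost L κ) q) (hstein : SteinIntegrable H p q)
    (hsmall : SmallStep p κ ε q) (hkl : klDiv q (targetMeasure p) ≠ ∞) :
    klDiv (svgdStep p κ ε q) (targetMeasure p) ≠ ∞ ∧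
      (klDiv (svgdStep p κ ε q) (targetMeasure p)).toReal - (klDiv q (targetMeasure p)).toReal
        ≤ -ε * steinDiscrepancy H q p ^ 2 * (1 - ε * ∫ x, stepCost L κ x ∂q) := by
  have hk := differentiable_featureMap (H := H) hκ hκ_C2
  obtain ⟨g, hdir, hdisc, hg⟩ := exists_svgdDirection_eq_rkhsField hκ hk q hstein
  have hφ : Differentiable ℝ (rkhsField H g) :=
    fun x => (differentiableAt_rkhsField_and_fderiv_apply hk g x).1
  rw [SmallStep, hdir] at hsmall
  rw [svgdStep, hdir, hdisc]
  have hlogp : Differentiable ℝ fun x => Real.log (p x) := hp_C2.differentiable (by norm_num)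
  have hpm : Measurable p := by
    have : p = fun x => Real.exp (Real.log (p x)) := by ext x; rw [Real.exp_log (hp_pos x)]
    rw [this]
    exact Real.measurable_exp.comp hlogp.continuous.measurable
  have hpint : Integrable p := by
    by_contra h
    rw [integral_undef h] at hp_int
    exact zero_ne_one hp_int
  have : IsFiniteMeasure (targetMeasure p) := isFiniteMeasure_withDensity_ofReal hpint.2
  set T : EuclideanSpace ℝ (Fin d) → EuclideanSpace ℝ (Fin d) :=
    fun x => x + ε • rkhsField H g x with hT
  have hTd : Differentiable ℝ T := differentiable_id.add (hφ.const_smul ε)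
  have hbij : Function.Bijective T := by
    refine bijective_id_add_of_norm_fderiv_le (hφ.const_smul ε) fun x => ?_
    have h : fderiv ℝ (fun y => ε • rkhsField H g y) x = ε • fderiv ℝ (rkhsField H g) x :=
      ((hφ x).hasFDerivAt.const_smul ε).fderiv
    rw [h, norm_smul, Real.norm_of_nonneg hε.le]
    exact hsmall x
  have hratio := fun x => log_density_ratio_ge hlogp hp_lip hε x (hφ x) (hsmall x)
  have hr : Measurable fun x => Real.log (p (T x)) - Real.log (p x)
      + Real.log |(fderiv ℝ T x).det| := by
    have h1 : Measurable fun x => (fderiv ℝ T x).det :=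
      ContinuousLinearMap.continuous_det.measurable.comp (measurable_fderiv ℝ T)
    have h2 : Measurable fun x => Real.log |(fderiv ℝ T x).det| :=
      Real.measurable_log.comp (measurable_norm.comp h1)
    exact ((hlogp.continuous.measurable.comp hTd.continuous.measurable).sub
      hlogp.continuous.measurable).add h2
  have hemb : MeasurableEmbedding T := hTd.continuous.measurableEmbedding hbij.1
  have hℓ : Integrable (fun x => ε * (steinOperator p (rkhsField H g) x).trace
      - ε ^ 2 * (‖g‖ ^ 2 * stepCost L κ x)) q :=
    ((hstein g).const_mul ε).sub ((hcost.const_mul _).const_mul _)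
  obtain ⟨hfin, hle⟩ := klDiv_map_ne_top_and_sub_le hemb hr
    (map_withDensity_exp_targetMeasure hp_pos hpm hTd hbij (fun x => (hratio x).1) hr) hℓ
    (fun x => by
      refine le_trans ?_ (hratio x).2
      have := mul_le_mul_of_nonneg_left (quadratic_error_le hκ hk L g x) (sq_nonneg ε)
      linarith) hkl
  refine ⟨hfin, hle.trans (le_of_eq ?_)⟩
  rw [integral_sub ((hstein g).const_mul ε) ((hcost.const_mul _).const_mul _),
    integral_const_mul, integral_const_mul, integral_const_mul, hg, real_inner_self_eq_norm_sq]
  ring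

theorem theorem1 {d : ℕ}
    (p : EuclideanSpace ℝ (Fin d) → ℝ) (hp_pos : ∀ x, 0 < p x) (hp_int : ∫ x, p x = 1)
    (hp_C2 : ContDiff ℝ 2 (fun x => Real.log (p x)))
    (L : ℝ≥0) (hp_lip : LipschitzWith L (score p))
    (κ : EuclideanSpace ℝ (Fin d) → EuclideanSpace ℝ (Fin d) → ℝ)
    (hκ_C2 : ContDiff ℝ 2 (fun z : EuclideanSpace ℝ (Fin d) × EuclideanSpace ℝ (Fin d) =>
      κ z.1 z.2))
    (H : Type*) [NormedAddCommGroup H] [InnerProductSpace ℝ H] [CompleteSpace H]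
    [RKHS ℝ H (EuclideanSpace ℝ (Fin d)) ℝ]
    (hκ : ∀ x y, RKHS.kernel H x y 1 = κ x y)
    (q₀ : Measure (EuclideanSpace ℝ (Fin d))) [IsProbabilityMeasure q₀]
    (ε : ℝ) (hε : 0 < ε) :
    (∀ t : ℕ,
      Integrable (stepCost L κ) (svgdLaw p κ ε q₀ t) →
      SteinIntegrable H p (svgdLaw p κ ε q₀ t) →
      SmallStep p κ ε (svgdLaw p κ ε q₀ t) →
      klDiv (svgdLaw p κ ε q₀ t) (targetMeasure p) ≠ ∞ →
      klDiv (svgdLaw p κ ε q₀ (t + 1)) (targetMeasure p) ≠ ∞ ∧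
      (klDiv (svgdLaw p κ ε q₀ (t + 1)) (targetMeasure p)).toReal
          - (klDiv (svgdLaw p κ ε q₀ t) (targetMeasure p)).toReal
        ≤ -ε * steinDiscrepancy H (svgdLaw p κ ε q₀ t) p ^ 2
            * (1 - ε * ∫ x, stepCost L κ x ∂(svgdLaw p κ ε q₀ t)) ∧
      (ε * ∫ x, stepCost L κ x ∂(svgdLaw p κ ε q₀ t) ≤ 1 →
        klDiv (svgdLaw p κ ε q₀ (t + 1)) (targetMeasure p)
          ≤ klDiv (svgdLaw p κ ε q₀ t) (targetMeasure p)) ∧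
      (ε * ∫ x, stepCost L κ x ∂(svgdLaw p κ ε q₀ t) < 1 →
        steinDiscrepancy H (svgdLaw p κ ε q₀ t) p ≠ 0 →
        klDiv (svgdLaw p κ ε q₀ (t + 1)) (targetMeasure p)
          < klDiv (svgdLaw p κ ε q₀ t) (targetMeasure p))) ∧
    ((∀ t : ℕ,
      Integrable (stepCost L κ) (svgdLaw p κ ε q₀ t) ∧
      SteinIntegrable H p (svgdLaw p κ ε q₀ t) ∧
      SmallStep p κ ε (svgdLaw p κ ε q₀ t) ∧
      ε * ∫ x, stepCost L κ x ∂(svgdLaw p κ ε q₀ t) ≤ 1) →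
      Antitone fun t => klDiv (svgdLaw p κ ε q₀ t) (targetMeasure p)) := by
  have step : ∀ t : ℕ,
      Integrable (stepCost L κ) (svgdLaw p κ ε q₀ t) →
      SteinIntegrable H p (svgdLaw p κ ε q₀ t) →
      SmallStep p κ ε (svgdLaw p κ ε q₀ t) →
      klDiv (svgdLaw p κ ε q₀ t) (targetMeasure p) ≠ ∞ →
      klDiv (svgdLaw p κ ε q₀ (t + 1)) (targetMeasure p) ≠ ∞ ∧
      (klDiv (svgdLaw p κ ε q₀ (t + 1)) (targetMeasure p)).toReal
          - (klDiv (svgdLaw p κ ε q₀ t) (targetMeasure p)).toReal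
        ≤ -ε * steinDiscrepancy H (svgdLaw p κ ε q₀ t) p ^ 2
            * (1 - ε * ∫ x, stepCost L κ x ∂(svgdLaw p κ ε q₀ t)) := by
    intro t h1 h2 h3 h4
    have := isFiniteMeasure_svgdLaw p κ ε q₀ t
    exact klDiv_svgdStep_ne_top_and_sub_le hp_pos hp_int hp_C2 hp_lip hκ_C2 hκ _ hε h1 h2 h3 h4
  have mono : ∀ t : ℕ,
      Integrable (stepCost L κ) (svgdLaw p κ ε q₀ t) →
      SteinIntegrable H p (svgdLaw p κ ε q₀ t) →
      SmallStep p κ ε (svgdLaw p κ ε q₀ t) →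
      ε * ∫ x, stepCost L κ x ∂(svgdLaw p κ ε q₀ t) ≤ 1 →
      klDiv (svgdLaw p κ ε q₀ (t + 1)) (targetMeasure p)
          ≤ klDiv (svgdLaw p κ ε q₀ t) (targetMeasure p) := by
    intro t h1 h2 h3 hc
    by_cases h4 : klDiv (svgdLaw p κ ε q₀ t) (targetMeasure p) = ∞
    · rw [h4]; exact le_top
    obtain ⟨hfin, hle⟩ := step t h1 h2 h3 h4
    rw [← ENNReal.toReal_le_toReal hfin h4]
    have := mul_nonneg (mul_nonneg hε.le (sq_nonneg (steinDiscrepancy H (svgdLaw p κ ε q₀ t) p)))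
      (sub_nonneg.2 hc)
    linarith
  refine ⟨fun t h1 h2 h3 h4 => ?_, fun h => antitone_nat_of_succ_le fun t =>
    mono t (h t).1 (h t).2.1 (h t).2.2.1 (h t).2.2.2⟩
  obtain ⟨hfin, hle⟩ := step t h1 h2 h3 h4
  refine ⟨hfin, hle, mono t h1 h2 h3, fun hc hD => ?_⟩
  rw [← ENNReal.toReal_lt_toReal hfin h4]
  have := mul_pos (mul_pos hε (pow_pos (abs_pos.2 hD) 2)) (sub_pos.2 hc)
  rw [sq_abs] at this
  linarith
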